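/- For real $\lambda$ and $x>0$ let $$J_\lambda(x)=\sum_{k=0}^\infty \frac{(-1)^k}{k!\,\Gamma(\lambda+k+1)}\Big(\frac x2\Big)^{2k+\lambda}$$ be the Bessel function of the first kind, and for an integer $n\ge 0$ and $\lambda>0$ let $$R_{n,\lambda}(x)=\sum_{k=0}^{\lfloor n/2\rfloor}(-1)^k\binom{n-k}{k}\frac{\Gamma(\lambda+n-k)}{\Gamma(\lambda+k)}\Big(\frac x2\Big)^{2k-n}$$ be the Lommel polynomial (a polynomial in $1/x$). Let $\nu>-1$ be real and let $m\ge 1$ be an integer. Suppose that $J_\nu$ and $J_{\nu+m}$ have no common positive zero. Then the set of positive zeros of $J_\nu$ and the set of positive zeros of the product $R_{m-1,\nu+1}J_{\nu+m}$ (that is, the union of the positive zeros of $J_{\nu+m}$ and of $R_{m-1,\nu+1}$) can be listed completely, in strictly ascending order, as infinite sequences $(j_{\nu,k})_{k\ge1}$ and $(\omega_k)_{k\ge1}$, and these interlace: $$0<j_{\nu,1}<\omega_1<j_{\nu,2}<\omega_2<\cdots .$$ Moreover, for $m\in\{1,2\}$ this gives, without any assumption on common zeros, the classical interlacing of the positive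 zeros $j_{\nu,k}$ of $J_\nu$ and $j_{\nu+m,k}$ of $J_{\nu+m}$: $$0<j_{\nu,1}<j_{\nu+m,1}<j_{\nu,2}<j_{\nu+m,2}<\cdots .$$ -/

import Mathlib

/-- The Bessel function of the first kind `J_ν(x)`, by its power series. It is used for `0 < x`.
Since `Real.Gamma` takes the value `0` at its poles and `a / 0 = 0`, the reciprocal Gamma factor is
`0` there, as usual. -/
noncomputable def besselJ (ν x : ℝ) : ℝ :=
  ∑' k : ℕ, (-1 : ℝ) ^ k / ((k.factorial : ℝ) * Real.Gamma (ν + k + 1)) *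
    (x / 2) ^ (2 * (k : ℝ) + ν)

/-- The Lommel polynomial `R_{n,ν}(x)`, a polynomial in `1 / x`. It is used for `0 < ν`, `0 < x`. -/
noncomputable def lommelR (n : ℕ) (ν x : ℝ) : ℝ :=
  ∑ k ∈ Finset.range (n / 2 + 1), (-1 : ℝ) ^ k * ((n - k).choose k : ℝ) *
    (Real.Gamma (ν + n - k) / Real.Gamma (ν + k)) * (x / 2) ^ (2 * (k : ℤ) - (n : ℤ))

/-- The set of positive zeros of a real function. -/
def posZeros (f : ℝ → ℝ) : Set ℝ := {x | 0 < x ∧ f x = 0}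

/-- The set of positive zeros common to `J_ν` and `J_{ν+m}`. -/
def commonZeros (m : ℕ) (ν : ℝ) : Set ℝ :=
  {x | x ∈ posZeros (besselJ ν) ∧ besselJ (ν + m) x = 0}

/-- The union of the positive zeros of `J_{ν+m}` and those of `R_{m-1,ν+1}` (for `1 ≤ m`). -/
def omegaSet (m : ℕ) (ν : ℝ) : Set ℝ :=
  posZeros (besselJ (ν + m)) ∪ posZeros (lommelR (m - 1) (ν + 1))

/-- `omegaSet m ν` is the set of positive zeros of the product `R_{m-1,ν+1} J_{ν+m}`. -/
theorem omegaSet_eq (m : ℕ) (ν : ℝ) :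
    omegaSet m ν = posZeros (fun x => lommelR (m - 1) (ν + 1) x * besselJ (ν + m) x) := by
  ext x
  simp only [omegaSet, posZeros, Set.mem_union, Set.mem_ofPred_eq, mul_eq_zero]
  tauto

/-- `a` lists all the elements of `S` in ascending order, without repetition: `S` is infinite and
`a 0 < a 1 < a 2 < ⋯` are its elements. Such an `a` is unique if it exists. -/
def IsAscendingEnum (S : Set ℝ) (a : ℕ → ℝ) : Prop :=
  StrictMono a ∧ Set.range a = S

/-- `S` and `T` can be listed completely in ascending order as `a 0, a 1, …` and `b 0, b 1, …`, and
`0 < a 0 < b 0 < a 1 < b 1 < ⋯`. -/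
def Interlace (S T : Set ℝ) : Prop :=
  ∃ a b : ℕ → ℝ, IsAscendingEnum S a ∧ IsAscendingEnum T b ∧
    0 < a 0 ∧ ∀ k, a k < b k ∧ b k < a (k + 1)

/-! Put t = x²/4 and J_μ(x) = (x/2)^μ g_μ(t), so that g_μ' = -g_{μ+1}; likewise R_{n,ν+1} becomes,
up to a power of x/2, a polynomial a_{n+1}(t). With m = n+1 and κ = ν+m, compare b = g_ν and H =
a_{n+1} g_κ. Differentiating g_ν = a_{n+2} g_κ - t a_{n+1} g_{κ+1} gives H'b - Hb' = g_κ² (a_{n+1}'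
a_{n+2} - a_{n+1} a_{n+2}') + a_{n+1}² Q_κ. Here Q_κ > 0 is a Turán inequality
(`besselG_turan_pos`), and the bracket is positive for n ≥ 1 (`lommelP_self_wronskian_pos`) and zero
for n = 0. The sum can vanish only where a_{n+1} = g_κ = 0, hence g_ν = 0: a common zero, which is
excluded. So H/b increases strictly between zeros of b, which gives interlacing
(`interlace_of_wronskian_pos`), once b has arbitrarily large zeros (`besselG_exists_zero_gt`). -/

/-! ### Power series g_μ: convergence, derivative, recurrence. -/

/-- The entire function `g_μ` with `J_μ(x) = (x / 2) ^ μ * g_μ(x ^ 2 / 4)`. -/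
noncomputable def besselG (μ t : ℝ) : ℝ :=
  ∑' k : ℕ, (-1 : ℝ) ^ k / ((k.factorial : ℝ) * Real.Gamma (μ + k + 1)) * t ^ k

/-- Gamma need not increase from μ + 1 to μ + 2, so k = 0 is bounded separately; from μ + 2 on, each
shift multiplies by a factor at least 1. -/
theorem inv_Gamma_shift_le {μ : ℝ} (hμ : -1 < μ) (k : ℕ) :
    (Real.Gamma (μ + k + 1))⁻¹ ≤ (Real.Gamma (μ + 1))⁻¹ + (Real.Gamma (μ + 2))⁻¹ := by
  have h1 : 0 < Real.Gamma (μ + 1) := Real.Gamma_pos_of_pos (by linarith)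
  have h2 : 0 < Real.Gamma (μ + 2) := Real.Gamma_pos_of_pos (by linarith)
  rcases k with _ | k
  · simp [h2.le]
  · have h3 : Real.Gamma (μ + 2) ≤ Real.Gamma (μ + (k + 1 : ℕ) + 1) := by
      induction k with
      | zero => simp [add_assoc, one_add_one_eq_two]
      | succ k ih =>
        refine ih.trans ?_
        have hk : (0 : ℝ) ≤ k := k.cast_nonneg
        have e : μ + ((k + 1 + 1 : ℕ) : ℝ) + 1 = (μ + (k + 1 : ℕ) + 1) + 1 := by
          push_cast; ring
        rw [e, Real.Gamma_add_one (s := μ + (k + 1 : ℕ) + 1) (by push_cast; linarith)]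
        have : 0 < Real.Gamma (μ + (k + 1 : ℕ) + 1) :=
          Real.Gamma_pos_of_pos (by push_cast; linarith)
        apply le_mul_of_one_le_left this.le
        push_cast; linarith
    have := inv_anti₀ h2 h3
    have := inv_pos.2 h1
    linarith

theorem abs_besselG_coeff_le {μ : ℝ} (hμ : -1 < μ) (k : ℕ) :
    |(-1 : ℝ) ^ k / ((k.factorial : ℝ) * Real.Gamma (μ + k + 1))| ≤
      ((Real.Gamma (μ + 1))⁻¹ + (Real.Gamma (μ + 2))⁻¹) / k.factorial := by
  have h : 0 < Real.Gamma (μ + k + 1) :=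
    Real.Gamma_pos_of_pos (by have : (0 : ℝ) ≤ k := k.cast_nonneg
                              linarith)
  rw [abs_div, abs_pow, abs_neg, abs_one, one_pow, abs_of_pos (by positivity),
    one_div, mul_inv, mul_comm, div_eq_mul_inv]
  exact mul_le_mul_of_nonneg_right (inv_Gamma_shift_le hμ k) (by positivity)

theorem summable_besselG {μ : ℝ} (hμ : -1 < μ) (t : ℝ) :
    Summable fun k : ℕ => (-1 : ℝ) ^ k / ((k.factorial : ℝ) * Real.Gamma (μ + k + 1)) * t ^ k := by
  refine Summable.of_norm_bounded ((Real.summable_pow_div_factorial |t|).mul_left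
    ((Real.Gamma (μ + 1))⁻¹ + (Real.Gamma (μ + 2))⁻¹)) fun k => ?_
  rw [Real.norm_eq_abs, abs_mul, abs_pow]
  refine (mul_le_mul_of_nonneg_right (abs_besselG_coeff_le hμ k) (by positivity)).trans_eq ?_
  ring

theorem besselG_zero {μ : ℝ} : besselG μ 0 = (Real.Gamma (μ + 1))⁻¹ := by
  rw [besselG, tsum_eq_single 0 (fun k hk => by simp [hk])]
  simp

theorem hasDerivAt_besselG {μ : ℝ} (hμ : -1 < μ) (t : ℝ) :
    HasDerivAt (besselG μ) (-besselG (μ + 1) t) t := by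
  set C := (Real.Gamma (μ + 1))⁻¹ + (Real.Gamma (μ + 2))⁻¹
  have hC : 0 ≤ C := by
    have h1 : 0 < Real.Gamma (μ + 1) := Real.Gamma_pos_of_pos (by linarith)
    have h2 : 0 < Real.Gamma (μ + 2) := Real.Gamma_pos_of_pos (by linarith)
    positivity
  set r := |t| + 1
  have hr : 0 < r := by positivity
  have hu : Summable fun k : ℕ => C / k.factorial * (k * r ^ (k - 1)) := by
    rw [← summable_nat_add_iff 1]
    refine ((Real.summable_pow_div_factorial r).mul_left C).congr fun k => ?_
    rw [Nat.factorial_succ]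
    push_cast
    have : (k.factorial : ℝ) ≠ 0 := by positivity
    have : (k : ℝ) + 1 ≠ 0 := by positivity
    field_simp
  have key := hasDerivAt_tsum_of_isPreconnected hu (Metric.isOpen_ball (x := (0 : ℝ)) (ε := r))
    (convex_ball 0 r).isPreconnected
    (g := fun (k : ℕ) y => (-1 : ℝ) ^ k / ((k.factorial : ℝ) * Real.Gamma (μ + k + 1)) * y ^ k)
    (g' := fun (k : ℕ) y => (-1 : ℝ) ^ k / ((k.factorial : ℝ) * Real.Gamma (μ + k + 1)) *
      (k * y ^ (k - 1)))
    (fun k y _ => (hasDerivAt_pow k y).const_mul _)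
    (fun k y hy => by
      rw [mem_ball_zero_iff, Real.norm_eq_abs] at hy
      rw [Real.norm_eq_abs, abs_mul, abs_mul, abs_pow, Nat.abs_cast]
      have : _ ≤ C / _ := abs_besselG_coeff_le hμ k
      gcongr)
    (Metric.mem_ball_self hr) (summable_besselG hμ 0)
    (y := t) (by rw [mem_ball_zero_iff, Real.norm_eq_abs]; exact lt_add_one _)
  refine key.congr_deriv ?_
  have hs : Summable fun k : ℕ => (-1 : ℝ) ^ k / ((k.factorial : ℝ) * Real.Gamma (μ + k + 1)) *
      (k * t ^ (k - 1)) := by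
    refine Summable.of_norm_bounded hu fun k => ?_
    rw [Real.norm_eq_abs, abs_mul, abs_mul, abs_pow, Nat.abs_cast]
    have : _ ≤ C / _ := abs_besselG_coeff_le hμ k
    have ht : |t| ≤ r := (lt_add_one _).le
    gcongr
  rw [hs.tsum_eq_zero_add, besselG, ← tsum_neg]
  simp only [Nat.cast_zero, zero_mul, mul_zero, zero_add]
  refine tsum_congr fun k => ?_
  rw [Nat.factorial_succ, show μ + ((k + 1 : ℕ) : ℝ) + 1 = μ + 1 + k + 1 by push_cast; ring]
  have h1 : (k.factorial : ℝ) ≠ 0 := by positivity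
  have h2 : (k : ℝ) + 1 ≠ 0 := by positivity
  have h3 : Real.Gamma (μ + 1 + k + 1) ≠ 0 :=
    (Real.Gamma_pos_of_pos (by have : (0 : ℝ) ≤ k := k.cast_nonneg
                               linarith)).ne'
  push_cast
  field_simp
  ring

theorem besselG_recurrence {μ : ℝ} (hμ : -1 < μ) (t : ℝ) :
    besselG μ t = (μ + 1) * besselG (μ + 1) t - t * besselG (μ + 2) t := by
  have s1 := (summable_besselG (μ := μ + 1) (by linarith) t).mul_left (μ + 1)
  have s2 := (summable_besselG (μ := μ + 2) (by linarith) t).mul_left t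
  have s0 := summable_besselG hμ t
  simp only [besselG]
  rw [← tsum_mul_left, ← tsum_mul_left, s0.tsum_eq_zero_add, s1.tsum_eq_zero_add,
    add_sub_assoc, ← Summable.tsum_sub ((summable_nat_add_iff 1).2 s1) s2]
  have h0 : μ + 1 ≠ 0 := by linarith
  congr 1
  · have : Real.Gamma (μ + 1) ≠ 0 := (Real.Gamma_pos_of_pos (by linarith)).ne'
    simp only [pow_zero, Nat.factorial_zero, Nat.cast_zero, Nat.cast_one, add_zero, mul_one]
    rw [Real.Gamma_add_one h0]
    field_simp
  · refine tsum_congr fun k => ?_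
    have hk : (0 : ℝ) ≤ k := k.cast_nonneg
    have e1 : μ + ((k + 1 : ℕ) : ℝ) + 1 = μ + k + 2 := by push_cast; ring
    have e2 : μ + 1 + ((k + 1 : ℕ) : ℝ) + 1 = μ + k + 2 + 1 := by push_cast; ring
    have e3 : μ + 2 + (k : ℝ) + 1 = μ + k + 2 + 1 := by ring
    have h3 : Real.Gamma (μ + k + 2) ≠ 0 := (Real.Gamma_pos_of_pos (by linarith)).ne'
    have h4 : μ + k + 2 ≠ 0 := by linarith
    have h1 : (k.factorial : ℝ) ≠ 0 := by positivity
    have h2 : (k : ℝ) + 1 ≠ 0 := by positivity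
    rw [e1, e2, e3, Real.Gamma_add_one h4, Nat.factorial_succ]
    push_cast
    field_simp
    ring

theorem besselJ_eq_besselG (μ : ℝ) {x : ℝ} (hx : 0 < x) :
    besselJ μ x = (x / 2) ^ μ * besselG μ (x ^ 2 / 4) := by
  rw [besselJ, besselG, ← tsum_mul_left]
  refine tsum_congr fun k => ?_
  have h : x ^ 2 / 4 = (x / 2) ^ 2 := by ring
  rw [Real.rpow_add (by positivity), h, ← pow_mul,
    show (2 : ℝ) * k = ((2 * k : ℕ) : ℝ) by push_cast; ring, Real.rpow_natCast]
  ring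

/-! ### Turán inequality and large zeros of g_μ. -/

/-- The Turán-type expression `t ^ (-μ) * (J_μ ^ 2 - J_{μ-1} J_{μ+1})` is positive. -/
theorem besselG_turan_pos {μ : ℝ} (hμ : -1 < μ) {t : ℝ} (ht : 0 < t) :
    0 < besselG μ t ^ 2 - μ * besselG μ t * besselG (μ + 1) t + t * besselG (μ + 1) t ^ 2 := by
  set Q : ℝ → ℝ := fun t =>
    besselG μ t ^ 2 - μ * besselG μ t * besselG (μ + 1) t + t * besselG (μ + 1) t ^ 2 with hQ
  have hd (s : ℝ) := hasDerivAt_besselG hμ s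
  have hd' (s : ℝ) := hasDerivAt_besselG (μ := μ + 1) (by linarith) s
  have hQd (s : ℝ) := (((hd s).pow 2).sub (((hd s).const_mul μ).mul (hd' s))).add
    ((hasDerivAt_id s).mul ((hd' s).pow 2))
  -- The recurrence collapses the derivative to a nonnegative expression. Monotonicity from 0 would
  -- give only `0 ≤ Q t`; strictness comes from a point near 0, where `Q` is close to `Q 0 > 0`.
  have hpow {s : ℝ} (hs : 0 < s) : HasDerivAt (fun s => s ^ (μ + 1) * Q s)
      (s ^ μ * besselG μ s ^ 2) s := by
    have h := (Real.hasDerivAt_rpow_const (p := μ + 1) (Or.inl hs.ne')).mul (hQd s)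
    refine h.congr_deriv ?_
    have e := besselG_recurrence hμ s
    rw [show μ + 1 + 1 = μ + 2 by ring, show μ + 1 - 1 = μ by ring, Real.rpow_add_one hs.ne']
    simp only [Pi.add_apply, Pi.sub_apply, Pi.mul_apply, Pi.pow_apply, id]
    set A := besselG μ s
    set B := besselG (μ + 1) s
    set D := besselG (μ + 2) s
    push_cast
    linear_combination (s ^ μ) * (μ * A - 2 * s * B) * e
  have h0 : 0 < Q 0 := by
    have hG : 0 < Real.Gamma (μ + 1) := Real.Gamma_pos_of_pos (by linarith)
    have h1 : 0 < μ + 1 := by linarith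
    simp only [hQ, besselG_zero]
    rw [Real.Gamma_add_one h1.ne']
    have : (Real.Gamma (μ + 1))⁻¹ ^ 2 - μ * (Real.Gamma (μ + 1))⁻¹ *
        ((μ + 1) * Real.Gamma (μ + 1))⁻¹ + 0 * ((μ + 1) * Real.Gamma (μ + 1))⁻¹ ^ 2 =
        (Real.Gamma (μ + 1))⁻¹ ^ 2 / (μ + 1) := by
      field_simp
      ring
    rw [this]
    positivity
  have hev : ∀ᶠ s in nhdsWithin (0 : ℝ) (Set.Ioi 0), 0 < Q s :=
    ((hQd 0).continuousAt.eventually_const_lt h0).filter_mono nhdsWithin_le_nhds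
  obtain ⟨s, hs, hst, hs0⟩ := (Filter.Eventually.and hev (Ioo_mem_nhdsGT ht)).exists
  have hmono : MonotoneOn (fun s => s ^ (μ + 1) * Q s) (Set.Ioi 0) := by
    refine monotoneOn_of_deriv_nonneg (convex_Ioi 0)
      (fun s hs => (hpow hs).continuousAt.continuousWithinAt)
      (fun s hs => (hpow (interior_subset hs)).differentiableAt.differentiableWithinAt)
      fun s hs => ?_
    rw [interior_Ioi] at hs
    rw [(hpow hs).deriv]
    have : (0 : ℝ) < s := hs
    positivity
  have h := hmono (Set.mem_Ioi.2 hst) (Set.mem_Ioi.2 ht) hs0.le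
  have : 0 < t ^ (μ + 1) * Q t := lt_of_lt_of_le (by positivity) h
  exact pos_of_mul_pos_right this (by positivity)

/-- A Prüfer angle argument: without zeros beyond T, w = J_{μ+1}/J_μ solves a Riccati equation for
all large x, and arctan w grows at rate at least 1/2. Over a length 2π it would gain π, more than
its range allows. -/
theorem besselG_exists_zero_gt {μ : ℝ} (hμ : -1 < μ) (T : ℝ) : ∃ t > T, besselG μ t = 0 := by
  by_contra! hne
  -- The first summand forces x²/4 > T, the second |(2μ+1)/x| ≤ 1.
  set X : ℝ := 2 * (|T| + 1) + |2 * μ + 1| with hX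
  have hT : 0 ≤ |T| := abs_nonneg T
  have hM : 0 ≤ |2 * μ + 1| := abs_nonneg _
  have hlt {x : ℝ} (hx : X ≤ x) : T < x ^ 2 / 4 := by
    have := le_abs_self T
    nlinarith
  set w : ℝ → ℝ := fun x => x / 2 * besselG (μ + 1) (x ^ 2 / 4) / besselG μ (x ^ 2 / 4) with hw
  have hwd {x : ℝ} (hx : X ≤ x) :
      HasDerivAt w (1 + w x ^ 2 - (2 * μ + 1) / x * w x) x := by
    have hx0 : x ≠ 0 := by nlinarith
    have hq : HasDerivAt (fun x : ℝ => x ^ 2 / 4) (x / 2) x := by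
      refine ((hasDerivAt_pow 2 x).div_const 4).congr_deriv ?_
      push_cast; ring
    have h0 := (hasDerivAt_besselG hμ (x ^ 2 / 4)).comp x hq
    have h1 := (hasDerivAt_besselG (μ := μ + 1) (by linarith) (x ^ 2 / 4)).comp x hq
    have hn := hne _ (hlt hx)
    refine ((((hasDerivAt_id x).div_const 2).mul h1).div h0 hn).congr_deriv ?_
    have e := besselG_recurrence hμ (x ^ 2 / 4)
    rw [show μ + 1 + 1 = μ + 2 by ring]
    simp only [hw, Function.comp, id, Pi.mul_apply]
    set A := besselG μ (x ^ 2 / 4)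
    set B := besselG (μ + 1) (x ^ 2 / 4)
    set D := besselG (μ + 2) (x ^ 2 / 4)
    field_simp
    linear_combination (-4 * A) * e
  have had {x : ℝ} (hx : X ≤ x) : HasDerivAt (fun x => Real.arctan (w x) - x / 2)
      (1 / (1 + w x ^ 2) * (1 + w x ^ 2 - (2 * μ + 1) / x * w x) - 1 / 2) x :=
    (hwd hx).arctan.sub ((hasDerivAt_id x).div_const 2)
  have hmono : MonotoneOn (fun x => Real.arctan (w x) - x / 2) (Set.Ici X) := by
    refine monotoneOn_of_deriv_nonneg (convex_Ici X)
      (fun s hs => (had hs).continuousAt.continuousWithinAt)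
      (fun s hs => (had (interior_subset hs)).differentiableAt.differentiableWithinAt)
      fun s hs => ?_
    have hs := interior_subset hs
    rw [(had hs).deriv]
    have hs0 : 0 < s := by have : X ≤ s := hs
                           linarith
    have hc : |(2 * μ + 1) / s| ≤ 1 := by
      rw [abs_div, abs_of_pos hs0, div_le_one hs0]
      have : X ≤ s := hs
      linarith
    have hc2 : (2 * μ + 1) / s * w s ≤ |w s| := by
      refine (le_abs_self _).trans ?_
      rw [abs_mul]
      exact mul_le_of_le_one_left (abs_nonneg _) hc
    have hw2 : |w s| ≤ (1 + w s ^ 2) / 2 := by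
      rw [← sq_abs]; nlinarith [sq_nonneg (|w s| - 1)]
    have hp : 0 < 1 + w s ^ 2 := by positivity
    rw [sub_nonneg, one_div_mul_eq_div, le_div_iff₀ hp]
    linarith
  have h := hmono (Set.self_mem_Ici) (show X + 2 * Real.pi ∈ Set.Ici X by
    simp [Real.pi_pos.le]) (by linarith [Real.pi_pos])
  have h1 := Real.neg_pi_div_two_lt_arctan (w X)
  have h2 := Real.arctan_lt_pi_div_two (w (X + 2 * Real.pi))
  simp only at h
  linarith

/-! ### Enumeration and interlacing of zeros on the half-line. -/

theorem exists_lt_and_lt_succ_of_strictMono {a : ℕ → ℝ} (hub : ∀ T, ∃ k, T < a k) {z : ℝ}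
    (h0 : a 0 < z) (hne : ∀ k, a k ≠ z) : ∃ k, a k < z ∧ z < a (k + 1) := by
  by_contra! h
  have hall (k : ℕ) : a k < z := by
    induction k with
    | zero => exact h0
    | succ k ih => exact lt_of_le_of_ne (h k ih) (hne _)
  obtain ⟨k, hk⟩ := hub z
  exact lt_asymm hk (hall k)

theorem exists_isAscendingEnum_of_isolated {b : ℝ → ℝ} (hb : Continuous b)
    (hiso : ∀ t ≥ 0, ∀ᶠ s in nhdsWithin t {t}ᶜ, b s ≠ 0)
    (hunb : ∀ T, ∃ t > T, b t = 0) :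
    ∃ a : ℕ → ℝ, IsAscendingEnum (posZeros b) a ∧ (∀ s, 0 < s → s < a 0 → b s ≠ 0) ∧
      (∀ k s, a k < s → s < a (k + 1) → b s ≠ 0) ∧ ∀ T, ∃ k, T < a k := by
  have hnext (t : ℝ) (ht : 0 ≤ t) : ∃ u > t, b u = 0 ∧ ∀ s, t < s → s < u → b s ≠ 0 := by
    obtain ⟨ε, hε, h⟩ := Metric.eventually_nhds_iff.1 (eventually_nhdsWithin_iff.1 (hiso t ht))
    have hgap (s : ℝ) (hs : t < s) (hs' : s < t + ε) : b s ≠ 0 :=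
      h (by rw [Real.dist_eq, abs_of_pos (sub_pos.2 hs)]; linarith) hs.ne'
    -- Isolation at t lets the search start at t + ε, where the zero set is closed and its infimum
    -- is attained.
    set Z := Set.Ici (t + ε) ∩ b ⁻¹' {0}
    have hZc : IsClosed Z := isClosed_Ici.inter (isClosed_singleton.preimage hb)
    have hZb : BddBelow Z := ⟨t + ε, fun x hx => hx.1⟩
    have hZn : Z.Nonempty := by
      obtain ⟨s, hs, hs0⟩ := hunb (t + ε)
      exact ⟨s, hs.le, hs0⟩
    have hm := hZc.csInf_mem hZn hZb
    refine ⟨sInf Z, ?_, hm.2, fun s hs hs' h0 => ?_⟩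
    · have : t + ε ≤ sInf Z := hm.1
      linarith
    · rcases lt_or_ge s (t + ε) with h1 | h1
      · exact hgap s hs h1 h0
      · exact absurd (csInf_le hZb (show s ∈ Z from ⟨h1, h0⟩)) (not_le.2 hs')
  choose! next hgt hzero hbetween using hnext
  set a : ℕ → ℝ := fun k => Nat.rec (next 0) (fun _ x => next x) k
  have hpos (k : ℕ) : 0 < a k := by
    induction k with
    | zero => exact hgt 0 le_rfl
    | succ k ih => exact ih.trans (hgt _ ih.le)
  have hz (k : ℕ) : b (a k) = 0 := by
    rcases k with _ | k
    · exact hzero 0 le_rfl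
    · exact hzero _ (hpos k).le
  have hmono : StrictMono a := strictMono_nat_of_lt_succ fun k => hgt _ (hpos k).le
  -- A bounded sequence of zeros would accumulate at its supremum, against isolation there.
  have hub (T : ℝ) : ∃ k, T < a k := by
    by_contra! hT
    have hbdd : BddAbove (Set.range a) := ⟨T, by rintro _ ⟨k, rfl⟩; exact hT k⟩
    have hlim := tendsto_atTop_ciSup hmono.monotone hbdd
    set l := ⨆ k, a k
    have hlt (k : ℕ) : a k < l := (hmono k.lt_succ_self).trans_le (le_ciSup hbdd (k + 1))
    have hlim' : Filter.Tendsto a Filter.atTop (nhdsWithin l {l}ᶜ) :=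
      tendsto_nhdsWithin_iff.2 ⟨hlim, Filter.Eventually.of_forall fun k => (hlt k).ne⟩
    obtain ⟨k, hk⟩ := (hlim'.eventually (hiso l ((hpos 0).trans (hlt 0)).le)).exists
    exact hk (hz k)
  refine ⟨a, ⟨hmono, ?_⟩, hbetween 0 le_rfl, fun k => hbetween _ (hpos k).le, hub⟩
  ext z
  constructor
  · rintro ⟨k, rfl⟩
    exact ⟨hpos k, hz k⟩
  · rintro ⟨hz0, hbz⟩
    by_contra hmem
    have hne (k : ℕ) : a k ≠ z := fun h => hmem ⟨k, h⟩
    have h0 : a 0 < z := by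
      by_contra! h
      exact hbetween 0 le_rfl z hz0 (lt_of_le_of_ne h (hne 0).symm) hbz
    obtain ⟨k, h1, h2⟩ := exists_lt_and_lt_succ_of_strictMono hub h0 hne
    exact hbetween _ (hpos k).le z h1 h2 hbz

/-- Two functions with a positive Wronskian on the positive half-line, both positive at the origin,
have interlacing positive zeros. -/
theorem interlace_of_wronskian_pos {b b' H H' : ℝ → ℝ} (hb : ∀ t, HasDerivAt b (b' t) t)
    (hH : ∀ t, HasDerivAt H (H' t) t) (hN : ∀ t, 0 < t → 0 < H' t * b t - H t * b' t)
    (hb0 : 0 < b 0) (hH0 : 0 < H 0) (hunb : ∀ T, ∃ t > T, b t = 0) :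
    Interlace (posZeros b) (posZeros H) := by
  have hbc : Continuous b := continuous_iff_continuousAt.2 fun t => (hb t).continuousAt
  have hHc : Continuous H := continuous_iff_continuousAt.2 fun t => (hH t).continuousAt
  have hiso : ∀ t ≥ 0, ∀ᶠ s in nhdsWithin t {t}ᶜ, b s ≠ 0 := by
    intro t ht
    by_cases h : b t = 0
    · have ht0 : 0 < t := lt_of_le_of_ne ht (by rintro rfl; exact hb0.ne' h)
      have hb' : b' t ≠ 0 := by
        intro h'
        have := hN t ht0
        simp [h, h'] at this
      exact (hb t).eventually_ne hb'
    · exact (hbc.continuousAt.eventually_ne h).filter_mono nhdsWithin_le_nhds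
  obtain ⟨a, haE, hgap0, hgap, hub⟩ := exists_isAscendingEnum_of_isolated hbc hiso hunb
  have hamem (k : ℕ) : 0 < a k ∧ b (a k) = 0 := by
    have : a k ∈ posZeros b := haE.2 ▸ Set.mem_range_self k
    exact this
  have hHa (k : ℕ) : H (a k) ≠ 0 := by
    intro h
    have := hN _ (hamem k).1
    simp [h, (hamem k).2] at this
  have hmono {u v : ℝ} (hu : 0 ≤ u) (huv : u < v) (hbn : ∀ s ∈ Set.Icc u v, b s ≠ 0) :
      H u / b u < H v / b v := by
    have hd (s : ℝ) (hs : s ∈ Set.Icc u v) := (hH s).div (hb s) (hbn s hs)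
    refine strictMonoOn_of_deriv_pos (f := H / b) (convex_Icc u v)
      (fun s hs => (hd s hs).continuousAt.continuousWithinAt) (fun s hs => ?_)
      (Set.left_mem_Icc.2 huv.le) (Set.right_mem_Icc.2 huv.le) huv
    have hs' := interior_subset hs
    rw [interior_Icc] at hs
    rw [(hd s hs').deriv]
    have := hN s (hu.trans_lt hs.1)
    have := hbn s hs'
    positivity
  -- Otherwise Rolle applies to b/H, and the Wronskian vanishes somewhere.
  have hex (k : ℕ) : ∃ z, a k < z ∧ z < a (k + 1) ∧ H z = 0 := by
    by_contra! h
    have hHn : ∀ s ∈ Set.Icc (a k) (a (k + 1)), H s ≠ 0 := by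
      rintro s ⟨h1, h2⟩
      rcases h1.eq_or_lt with rfl | h1
      · exact hHa k
      rcases h2.eq_or_lt with rfl | h2
      · exact hHa _
      exact h s h1 h2
    have hd (s : ℝ) (hs : s ∈ Set.Icc (a k) (a (k + 1))) := (hb s).div (hH s) (hHn s hs)
    obtain ⟨s, hs, hs0⟩ := exists_hasDerivAt_eq_zero (f := b / H) (haE.1 k.lt_succ_self)
      (fun s hs => (hd s hs).continuousAt.continuousWithinAt)
      (by simp [(hamem k).2, (hamem (k + 1)).2]) (fun s hs => hd s (Set.Ioo_subset_Icc_self hs))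
    have hne := hHn s (Set.Ioo_subset_Icc_self hs)
    rw [div_eq_zero_iff, or_iff_left (by positivity)] at hs0
    have := hN s ((hamem k).1.trans hs.1)
    linarith
  choose c hac hca hHc0 using hex
  have huniq {k : ℕ} {y z : ℝ} (hy : a k < y) (hyz : y < z) (hz : z < a (k + 1)) (hHy : H y = 0)
      (hHz : H z = 0) : False := by
    have := hmono ((hamem k).1.trans hy).le hyz
      fun s hs => hgap k s (hy.trans_le hs.1) (hs.2.trans_lt hz)
    simp [hHy, hHz] at this
  refine ⟨a, c, haE, ⟨strictMono_nat_of_lt_succ fun k => (hca k).trans (hac (k + 1)), ?_⟩,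
    (hamem 0).1, fun k => ⟨hac k, hca k⟩⟩
  ext z
  constructor
  · rintro ⟨k, rfl⟩
    exact ⟨(hamem k).1.trans (hac k), hHc0 k⟩
  · rintro ⟨hz0, hHz⟩
    have hne (k : ℕ) : a k ≠ z := fun h => hHa k (h ▸ hHz)
    -- H/b is positive at 0 and increasing, so H has no zero before `a 0`.
    have h0 : a 0 < z := by
      by_contra! h
      have hlt := lt_of_le_of_ne h (hne 0).symm
      have := hmono le_rfl hz0 fun s hs => by
        rcases hs.1.eq_or_lt with rfl | h1
        · exact hb0.ne'
        · exact hgap0 s h1 (hs.2.trans_lt hlt)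
      rw [hHz, zero_div] at this
      exact lt_asymm this (by positivity)
    obtain ⟨k, h1, h2⟩ := exists_lt_and_lt_succ_of_strictMono hub h0 hne
    refine ⟨k, ?_⟩
    rcases lt_trichotomy (c k) z with h | h | h
    · exact (huniq (hac k) h h2 (hHc0 k) hHz).elim
    · exact h
    · exact (huniq h1 h (hca k) hHz (hHc0 k)).elim

/-! ### Lommel polynomials in the variable t. -/

/-- The polynomials `a_n` in `t = x ^ 2 / 4` with
`R_{n,μ+1}(x) = (x / 2) ^ (-n) * a_{n+1}(x ^ 2 / 4)`. -/
def lommelP (μ t : ℝ) : ℕ → ℝ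
  | 0 => 0
  | 1 => 1
  | n + 2 => (μ + n + 1) * lommelP μ t (n + 1) - t * lommelP μ t n

/-- The derivative of `lommelP` with respect to `t`. -/
def lommelPDeriv (μ t : ℝ) : ℕ → ℝ
  | 0 => 0
  | 1 => 0
  | n + 2 => (μ + n + 1) * lommelPDeriv μ t (n + 1) - (lommelP μ t n + t * lommelPDeriv μ t n)

theorem hasDerivAt_lommelP (μ t : ℝ) :
    ∀ n, HasDerivAt (fun t => lommelP μ t n) (lommelPDeriv μ t n) t
  | 0 => hasDerivAt_const t 0
  | 1 => hasDerivAt_const t 1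
  | n + 2 => by
    have h := ((hasDerivAt_lommelP μ t (n + 1)).const_mul (μ + n + 1)).sub
      ((hasDerivAt_id t).mul (hasDerivAt_lommelP μ t n))
    refine h.congr_deriv ?_
    simp [lommelPDeriv]

theorem lommelP_zero_pos {μ : ℝ} (hμ : -1 < μ) (n : ℕ) : 0 < lommelP μ 0 (n + 1) := by
  induction n with
  | zero => simp [lommelP]
  | succ n ih =>
    rw [lommelP, zero_mul, sub_zero]
    have : (0 : ℝ) ≤ n := n.cast_nonneg
    exact mul_pos (by linarith) ih

/-- Iterating the three-term recurrence expresses g_μ through two consecutive higher orders. -/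
theorem lommelP_besselG_wronskian {μ : ℝ} (hμ : -1 < μ) (t : ℝ) (n : ℕ) :
    lommelP μ t (n + 1) * besselG (μ + n) t - t * lommelP μ t n * besselG (μ + n + 1) t =
      besselG μ t := by
  induction n with
  | zero => simp [lommelP]
  | succ n ih =>
    have e := besselG_recurrence (μ := μ + n) (by have : (0 : ℝ) ≤ n := n.cast_nonneg
                                                  linarith) t
    rw [← ih, lommelP]
    push_cast
    rw [← add_assoc, show μ + (n : ℝ) + 1 + 1 = μ + n + 2 by ring]
    linear_combination (-lommelP μ t (n + 1)) * e

/-- One use of the recurrence leaves a cross term a_k a_{k-1} of unknown sign; after two uses the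
cross terms combine into a positive multiple of a square. Hence the induction in steps of two. -/
theorem lommelP_self_wronskian_pos {μ : ℝ} (hμ : -1 < μ) {t : ℝ} (ht : 0 < t) :
    ∀ n : ℕ, 0 < lommelPDeriv μ t (n + 2) * lommelP μ t (n + 3) -
      lommelP μ t (n + 2) * lommelPDeriv μ t (n + 3)
  | 0 => by simp [lommelP, lommelPDeriv]; linarith
  | 1 => by
    have h : lommelPDeriv μ t 3 * lommelP μ t 4 - lommelP μ t 3 * lommelPDeriv μ t 4 =
        (μ + 2) * (μ + 1) ^ 2 := by
      simp [lommelP, lommelPDeriv]; ring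
    have : 0 < μ + 2 := by linarith
    have : 0 < μ + 1 := by linarith
    rw [show 1 + 2 = 3 from rfl, show 1 + 3 = 4 from rfl, h]
    positivity
  | n + 2 => by
    have ih := lommelP_self_wronskian_pos hμ ht n
    have hn : (0 : ℝ) < μ + (n + 2 : ℕ) + 1 := by
      have : (0 : ℝ) ≤ n := n.cast_nonneg
      push_cast; linarith
    have h : lommelPDeriv μ t (n + 2 + 2) * lommelP μ t (n + 2 + 3) -
        lommelP μ t (n + 2 + 2) * lommelPDeriv μ t (n + 2 + 3) =
        (μ + (n + 2 : ℕ) + 1) * lommelP μ t (n + 3) ^ 2 +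
        t ^ 2 * (lommelPDeriv μ t (n + 2) * lommelP μ t (n + 3) -
          lommelP μ t (n + 2) * lommelPDeriv μ t (n + 3)) := by
      have p (k : ℕ) : lommelP μ t (k + 2) =
        (μ + k + 1) * lommelP μ t (k + 1) - t * lommelP μ t k := rfl
      have d (k : ℕ) : lommelPDeriv μ t (k + 2) = (μ + k + 1) * lommelPDeriv μ t (k + 1) -
        (lommelP μ t k + t * lommelPDeriv μ t k) := rfl
      rw [show n + 2 + 3 = (n + 3) + 2 from rfl, p (n + 3), d (n + 3),
        show n + 3 + 1 = (n + 2) + 2 from rfl, p (n + 2), d (n + 2)]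
      push_cast
      ring
    rw [h]
    positivity

/-- The coefficient of `(-t) ^ k` in `lommelP μ t (n + 1)`, for `ξ = μ + 1`. -/
noncomputable def lommelCoeff (ξ : ℝ) (n k : ℕ) : ℝ :=
  ((n - k).choose k : ℝ) * (Real.Gamma (ξ + n - k) / Real.Gamma (ξ + k))

theorem lommelCoeff_eq_zero (ξ : ℝ) {n k : ℕ} (h : n / 2 < k) : lommelCoeff ξ n k = 0 := by
  rw [lommelCoeff, Nat.choose_eq_zero_of_lt (by omega), Nat.cast_zero, zero_mul]

theorem lommelCoeff_zero_right {ξ : ℝ} (hξ : 0 < ξ) (n : ℕ) :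
    lommelCoeff ξ (n + 1) 0 = (ξ + n) * lommelCoeff ξ n 0 := by
  have : (0 : ℝ) ≤ n := n.cast_nonneg
  have e : ξ + ((n + 1 : ℕ) : ℝ) = ξ + n + 1 := by push_cast; ring
  simp only [lommelCoeff, Nat.choose_zero_right, Nat.cast_zero, sub_zero, add_zero, e]
  rw [Real.Gamma_add_one (by linarith)]
  ring

theorem lommelCoeff_succ {ξ : ℝ} (hξ : 0 < ξ) (n k : ℕ) :
    lommelCoeff ξ (n + 2) (k + 1) =
      (ξ + n + 1) * lommelCoeff ξ (n + 1) (k + 1) + lommelCoeff ξ n k := by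
  rcases lt_or_ge n k with h | h
  · rw [lommelCoeff_eq_zero, lommelCoeff_eq_zero, lommelCoeff_eq_zero, mul_zero, zero_add] <;>
      omega
  obtain ⟨N, rfl⟩ := Nat.exists_eq_add_of_le h
  have hN : (0 : ℝ) ≤ N := N.cast_nonneg
  have hk : (0 : ℝ) ≤ k := k.cast_nonneg
  have hC : ((N.choose (k + 1) : ℕ) : ℝ) * (k + 1) = N.choose k * (N - k) := by
    rcases lt_or_ge N k with h | h
    · simp [Nat.choose_eq_zero_of_lt h, Nat.choose_eq_zero_of_lt (h.trans k.lt_succ_self)]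
    · have := Nat.choose_succ_right_eq N k
      rw [← Nat.cast_sub h]
      exact_mod_cast this
  simp only [lommelCoeff]
  rw [show k + N + 2 - (k + 1) = N + 1 by omega, show k + N + 1 - (k + 1) = N by omega,
    show k + N - k = N by omega, Nat.choose_succ_succ]
  push_cast
  rw [show ξ + ((k : ℝ) + N + 2) - (k + 1) = ξ + N + 1 by ring,
    show ξ + ((k : ℝ) + N + 1) - (k + 1) = ξ + N by ring,
    show ξ + ((k : ℝ) + N) - k = ξ + N by ring,
    show ξ + ((k : ℝ) + 1) = ξ + k + 1 by ring,
    Real.Gamma_add_one (by linarith), Real.Gamma_add_one (by linarith)]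
  have h1 : Real.Gamma (ξ + k) ≠ 0 := (Real.Gamma_pos_of_pos (by linarith)).ne'
  have h2 : ξ + k ≠ 0 := by linarith
  field_simp
  linear_combination -hC

theorem sum_lommelCoeff_extend (ξ t : ℝ) {n N : ℕ} (h : n / 2 + 1 ≤ N) :
    ∑ k ∈ Finset.range N, lommelCoeff ξ n k * (-t) ^ k =
      ∑ k ∈ Finset.range (n / 2 + 1), lommelCoeff ξ n k * (-t) ^ k := by
  symm
  refine Finset.sum_subset (Finset.range_mono h) fun k _ hk => ?_
  rw [Finset.mem_range] at hk
  rw [lommelCoeff_eq_zero ξ (by omega), zero_mul]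

theorem lommelP_eq_sum {μ : ℝ} (hμ : -1 < μ) (t : ℝ) :
    ∀ n : ℕ, lommelP μ t (n + 1) =
      ∑ k ∈ Finset.range (n / 2 + 1), lommelCoeff (μ + 1) n k * (-t) ^ k
  | 0 => by
    have : Real.Gamma (μ + 1) ≠ 0 := (Real.Gamma_pos_of_pos (by linarith)).ne'
    simp [lommelP, lommelCoeff, this]
  | 1 => by
    have h : Real.Gamma (μ + 1) ≠ 0 := (Real.Gamma_pos_of_pos (by linarith)).ne'
    simp [lommelP, lommelCoeff, Real.Gamma_add_one (show μ + 1 ≠ 0 by linarith), h]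
  | n + 2 => by
    have hξ : 0 < μ + 1 := by linarith
    rw [lommelP, lommelP_eq_sum hμ t n, lommelP_eq_sum hμ t (n + 1),
      -- Padding with vanishing coefficients aligns the three ranges despite the floors n/2.
      ← sum_lommelCoeff_extend (μ + 1) t (n := n) (N := n + 2) (by omega),
      ← sum_lommelCoeff_extend (μ + 1) t (n := n + 1) (N := n + 3) (by omega),
      ← sum_lommelCoeff_extend (μ + 1) t (n := n + 2) (N := n + 3) (by omega),
      Finset.sum_range_succ', Finset.sum_range_succ' _ (n + 2)]
    have hs : ∑ k ∈ Finset.range (n + 2), lommelCoeff (μ + 1) (n + 2) (k + 1) * (-t) ^ (k + 1) =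
        (μ + 1 + n + 1) *
          ∑ k ∈ Finset.range (n + 2), lommelCoeff (μ + 1) (n + 1) (k + 1) * (-t) ^ (k + 1) -
        t * ∑ k ∈ Finset.range (n + 2), lommelCoeff (μ + 1) n k * (-t) ^ k := by
      rw [Finset.mul_sum, Finset.mul_sum, ← Finset.sum_sub_distrib]
      refine Finset.sum_congr rfl fun k _ => ?_
      rw [lommelCoeff_succ hξ]
      ring
    rw [hs, lommelCoeff_zero_right hξ (n + 1)]
    push_cast
    ring

theorem lommelR_eq_lommelP {μ : ℝ} (hμ : -1 < μ) (n : ℕ) {x : ℝ} (hx : 0 < x) :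
    lommelR n (μ + 1) x = (x / 2) ^ (-(n : ℤ)) * lommelP μ (x ^ 2 / 4) (n + 1) := by
  rw [lommelR, lommelP_eq_sum hμ, Finset.mul_sum]
  refine Finset.sum_congr rfl fun k _ => ?_
  have h2 : x / 2 ≠ 0 := by positivity
  rw [lommelCoeff, show -(x ^ 2 / 4) = (-1) * (x / 2) ^ 2 by ring, mul_pow, ← pow_mul,
    sub_eq_add_neg (2 * (k : ℤ)), zpow_add₀ h2, show (2 * (k : ℤ)) = ((2 * k : ℕ) : ℤ) by simp,
    zpow_natCast]
  ring

/-! ### Transfer to x, and the main theorem. -/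

theorem Interlace.of_sq_div_four {S T S' T' : Set ℝ} (h : Interlace S' T')
    (hT' : T' ⊆ Set.Ioi 0)
    (hS : ∀ x, x ∈ S ↔ 0 < x ∧ x ^ 2 / 4 ∈ S') (hT : ∀ x, x ∈ T ↔ 0 < x ∧ x ^ 2 / 4 ∈ T') :
    Interlace S T := by
  obtain ⟨a, b, ha, hb, h0, hab⟩ := h
  have hapos (k : ℕ) : 0 < a k := h0.trans_le (ha.1.monotone k.zero_le)
  have hbpos (k : ℕ) : 0 < b k := hT' (hb.2 ▸ Set.mem_range_self k)
  have key {R R' : Set ℝ} {c : ℕ → ℝ} (hc : IsAscendingEnum R' c) (hpos : ∀ k, 0 < c k)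
      (hR : ∀ x, x ∈ R ↔ 0 < x ∧ x ^ 2 / 4 ∈ R') :
      IsAscendingEnum R fun k => 2 * √(c k) := by
    refine ⟨fun i j hij => ?_, ?_⟩
    · have := Real.sqrt_lt_sqrt (hpos i).le (hc.1 hij)
      simpa using this
    · ext x
      rw [hR, ← hc.2]
      constructor
      · rintro ⟨k, rfl⟩
        refine ⟨by have := Real.sqrt_pos.2 (hpos k)
                   positivity, k, ?_⟩
        simp only
        rw [mul_pow, Real.sq_sqrt (hpos k).le]
        ring
      · rintro ⟨hx, k, hk⟩
        refine ⟨k, ?_⟩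
        simp only
        rw [hk, show x ^ 2 / 4 = (x / 2) ^ 2 by ring, Real.sqrt_sq (by positivity)]
        ring
  refine ⟨_, _, key ha hapos hS, key hb hbpos hT, by have := Real.sqrt_pos.2 h0
                                                     positivity, fun k => ⟨?_, ?_⟩⟩
  · have := Real.sqrt_lt_sqrt (hapos k).le (hab k).1
    linarith
  · have := Real.sqrt_lt_sqrt (hbpos k).le (hab k).2
    linarith

theorem mem_posZeros_besselJ {μ x : ℝ} :
    x ∈ posZeros (besselJ μ) ↔ 0 < x ∧ x ^ 2 / 4 ∈ posZeros (besselG μ) := by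
  refine and_congr_right fun hx => ?_
  have : (x / 2) ^ μ ≠ 0 := by positivity
  rw [besselJ_eq_besselG μ hx, mul_eq_zero, or_iff_right this]
  exact (and_iff_right (by positivity)).symm

theorem mem_posZeros_lommelR {μ : ℝ} (hμ : -1 < μ) (n : ℕ) {x : ℝ} :
    x ∈ posZeros (lommelR n (μ + 1)) ↔
      0 < x ∧ x ^ 2 / 4 ∈ posZeros fun t => lommelP μ t (n + 1) := by
  refine and_congr_right fun hx => ?_
  have : (x / 2) ^ (-(n : ℤ)) ≠ 0 := by positivity
  rw [lommelR_eq_lommelP hμ n hx, mul_eq_zero, or_iff_right this]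
  exact (and_iff_right (by positivity)).symm

/-- The zeros of `g_μ` interlace with those of `a_{n+1} g_{μ+n+1}`. -/
theorem interlace_besselG {μ : ℝ} (hμ : -1 < μ) (n : ℕ)
    (hc : ∀ t, 0 < t → besselG μ t = 0 → besselG (μ + (n + 1 : ℕ)) t ≠ 0) :
    Interlace (posZeros (besselG μ))
      (posZeros fun t => lommelP μ t (n + 1) * besselG (μ + (n + 1 : ℕ)) t) := by
  have hn : -1 < μ + ((n + 1 : ℕ) : ℝ) := by
    have : (0 : ℝ) ≤ n := n.cast_nonneg
    push_cast; linarith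
  have hH (t : ℝ) := (hasDerivAt_lommelP μ t (n + 1)).mul (hasDerivAt_besselG hn t)
  refine interlace_of_wronskian_pos (hasDerivAt_besselG hμ) hH (fun t ht => ?_) ?_ ?_
    (besselG_exists_zero_gt hμ)
  · have hW (s : ℝ) := lommelP_besselG_wronskian hμ s (n + 1)
    -- Both sides of the identity `hW` are differentiated at t.
    have hdW := (((hasDerivAt_lommelP μ t (n + 2)).mul (hasDerivAt_besselG hn t)).sub
      (((hasDerivAt_id t).mul (hasDerivAt_lommelP μ t (n + 1))).mul
        (hasDerivAt_besselG (μ := μ + (n + 1 : ℕ) + 1) (by linarith) t))).unique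
      ((hasDerivAt_besselG hμ t).congr_of_eventuallyEq (Filter.Eventually.of_forall hW))
    have hQ := besselG_turan_pos hn ht
    have hr := besselG_recurrence hn t
    have hWt := hW t
    rw [show μ + ((n + 1 : ℕ) : ℝ) + 1 + 1 = μ + (n + 1 : ℕ) + 2 by ring] at hdW
    simp only [id, Pi.mul_apply] at hdW
    set κ := μ + ((n + 1 : ℕ) : ℝ) with hκ
    have hN : (lommelPDeriv μ t (n + 1) * besselG κ t +
          lommelP μ t (n + 1) * -besselG (κ + 1) t) * besselG μ t -
        lommelP μ t (n + 1) * besselG κ t * -besselG (μ + 1) t =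
        besselG κ t ^ 2 * (lommelPDeriv μ t (n + 1) * lommelP μ t (n + 2) -
          lommelP μ t (n + 1) * lommelPDeriv μ t (n + 2)) +
        lommelP μ t (n + 1) ^ 2 * (besselG κ t ^ 2 - κ * besselG κ t * besselG (κ + 1) t +
          t * besselG (κ + 1) t ^ 2) := by
      rw [← hdW, ← hWt]
      linear_combination (-(lommelP μ t (n + 1)) ^ 2 * besselG κ t) * hr
    rw [hN]
    -- For n = 0 the polynomial bracket is zero and a_1 = 1, so the Turán term alone decides.
    rcases n with _ | n
    · simpa [lommelP, lommelPDeriv] using hQ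
    · have hS := lommelP_self_wronskian_pos hμ ht n
      by_cases h : besselG κ t = 0
      · have : lommelP μ t (n + 1 + 1) ≠ 0 := by
          intro h'
          rw [h, h'] at hWt
          exact hc t ht (by linarith) h
        positivity
      · positivity
  · rw [besselG_zero]
    exact inv_pos.2 (Real.Gamma_pos_of_pos (by linarith))
  · rw [besselG_zero]
    exact mul_pos (lommelP_zero_pos hμ n) (inv_pos.2 (Real.Gamma_pos_of_pos (by linarith)))

/-- At a common zero of g_μ and g_{μ+1} the Turán expression would vanish; for m = 2 the recurrence
reduces to this case. -/
theorem besselG_add_ne_zero {μ : ℝ} (hμ : -1 < μ) {m : ℕ} (hm : 1 ≤ m) (hm2 : m ≤ 2) {t : ℝ}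
    (ht : 0 < t) (h : besselG μ t = 0) : besselG (μ + m) t ≠ 0 := by
  have hQ := besselG_turan_pos hμ ht
  have h1 : besselG (μ + 1) t ≠ 0 := by
    intro h1
    simp [h, h1] at hQ
  interval_cases m
  · simpa using h1
  · intro h2
    have e := besselG_recurrence hμ t
    push_cast at h2
    rw [h, h2, mul_zero, sub_zero] at e
    exact mul_ne_zero (by linarith) h1 e.symm

theorem interlace_besselJ_omegaSet {ν : ℝ} (hν : -1 < ν) {m : ℕ} (hm : 1 ≤ m)
    (hc : ∀ t, 0 < t → besselG ν t = 0 → besselG (ν + m) t ≠ 0) :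
    Interlace (posZeros (besselJ ν)) (omegaSet m ν) := by
  obtain ⟨n, rfl⟩ := Nat.exists_eq_add_of_le' hm
  refine (interlace_besselG hν n hc).of_sq_div_four (fun t ht => ht.1)
    (fun x => mem_posZeros_besselJ) fun x => ?_
  rw [omegaSet, Set.mem_union, mem_posZeros_besselJ, Nat.add_sub_cancel, mem_posZeros_lommelR hν]
  simp only [posZeros, Set.mem_ofPred_eq, mul_eq_zero]
  tauto

/-- The polynomials involved, a_1 = 1 and a_2 = ν + 1, are nonzero constants. -/
theorem omegaSet_eq_posZeros_besselJ {ν : ℝ} (hν : -1 < ν) {m : ℕ} (hm : 1 ≤ m) (hm2 : m ≤ 2) :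
    omegaSet m ν = posZeros (besselJ (ν + m)) := by
  refine Set.union_eq_left.2 fun x hx => ?_
  rw [mem_posZeros_lommelR hν] at hx
  have h := hx.2.2
  have : ν + 1 ≠ 0 := by linarith
  interval_cases m <;> simp [lommelP, this] at h

theorem theorem3p1 (ν : ℝ) (hν : -1 < ν) (m : ℕ) (hm : 1 ≤ m) :
    (commonZeros m ν = ∅ → Interlace (posZeros (besselJ ν)) (omegaSet m ν)) ∧
    (m ≤ 2 → Interlace (posZeros (besselJ ν)) (posZeros (besselJ (ν + m)))) := by
  refine ⟨fun h => interlace_besselJ_omegaSet hν hm fun t ht h0 h1 => ?_, fun hm2 => ?_⟩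
  · have hx : 0 < 2 * √t := by positivity
    have hq : (2 * √t) ^ 2 / 4 = t := by
      rw [mul_pow, Real.sq_sqrt ht.le]
      ring
    have hmem : 2 * √t ∈ commonZeros m ν := by
      refine ⟨mem_posZeros_besselJ.2 ⟨hx, ?_⟩, ?_⟩
      · rw [hq]
        exact ⟨ht, h0⟩
      · rw [besselJ_eq_besselG _ hx, hq, h1, mul_zero]
    rw [h] at hmem
    exact hmem
  · rw [← omegaSet_eq_posZeros_besselJ hν hm hm2]
    exact interlace_besselJ_omegaSet hν hm fun t ht => besselG_add_ne_zero hν hm hm2 ht
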